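/- Let $G$ be a group and let $\varphi$ be an automorphism of $G$ of finite order $m$. Put $$G_\varphi = G\rtimes_\varphi \mathbb Z_m=\langle G,t \mid tgt^{-1}=\varphi(g)\ \ (g\in G),\ t^m=1\rangle .$$ Suppose that $G_\varphi$ has a non-elementary action by isometries on a Gromov-hyperbolic length space $X$. Then $G$ has infinitely many $\varphi$-twisted conjugacy classes, i.e. the equivalence relation $x\sim g\,x\,\varphi(g)^{-1}$ ($x,g\in G$) on $G$ has infinitely many classes. Here $X$ is a metric space in which the distance between any two points is the infimum of the lengths of the paths joining them, and which satisfies Gromov's condition $(x\mid z)_w\ge \min\{(x\mid y)_w,(y\mid z)_w\}-\delta$ for all $x,y,z,w\in X$ and some constant $\delta$, where $(x\mid y)_w=\tfrac12\big(d(x,w)+d(y,w)-d(x,y)\big)$; $X$ is not assumed proper, complete or geodesic. Its boundary $\partial X$ is the set of classes of sequences $(x_i)$ with $(x_i\mid x_j)_w\to\infty$ as $i,j\to\infty$, where $(x_i)$ and $(y_j)$ are equivalent if $(x_i\mid y_j)_w\to\infty$ as $i,j\to\infty$. The action is *elementary* if every element of the group is elliptic (that is, the cyclic group it generates has bounded orbits),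 or there is a global fixed point in $X\cup\partial X$, or there is a two-element subset of $\partial X$ invariant under the group; it is *non-elementary* otherwise. -/

import Mathlib

open Filter

/-! ### Twisted conjugacy -/

/-- `x` and `y` are `φ`-conjugate if `y = g x φ(g⁻¹)` for some `g`. -/
def TwistedConj {G : Type*} [Group G] (φ : MulAut G) (x y : G) : Prop :=
  ∃ g : G, y = g * x * φ g⁻¹

/-- The equivalence relation of `φ`-twisted conjugacy. -/
def twistedConjSetoid {G : Type*} [Group G] (φ : MulAut G) : Setoid G where
  r := TwistedConj φ
  iseqv :=
    { refl := fun x => ⟨1, by simp⟩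
      symm := by
        rintro x y ⟨g, rfl⟩
        exact ⟨g⁻¹, by simp [mul_assoc]⟩
      trans := by
        rintro x y z ⟨g, rfl⟩ ⟨h, rfl⟩
        exact ⟨h * g, by simp [mul_assoc]⟩ }

/-- The set of `φ`-twisted conjugacy (Reidemeister) classes. -/
def TwistedConjClasses {G : Type*} [Group G] (φ : MulAut G) : Type _ :=
  Quotient (twistedConjSetoid φ)

/-! ### The semidirect product with the cyclic group generated by `φ` -/

/-- The homomorphism `ℤ_m → Aut G` sending the generator `1` to `φ`, where `m` is the order
of `φ`. -/
noncomputable def cyclicAction {G : Type*} [Group G] (φ : MulAut G) :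
    Multiplicative (ZMod (orderOf φ)) →* MulAut G :=
  AddMonoidHom.toMultiplicativeLeft
    (ZMod.lift (orderOf φ) (A := Additive (MulAut G))
      ⟨zmultiplesHom (Additive (MulAut G)) (Additive.ofMul φ), by
        simp [← ofMul_pow, pow_orderOf_eq_one]⟩)

/-- The generator of `ℤ_m` acts by `φ`. -/
theorem cyclicAction_one {G : Type*} [Group G] (φ : MulAut G) :
    cyclicAction φ (Multiplicative.ofAdd 1) = φ := by
  have h := ZMod.lift_coe (orderOf φ) (A := Additive (MulAut G))
      ⟨zmultiplesHom (Additive (MulAut G)) (Additive.ofMul φ), by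
        simp [← ofMul_pow, pow_orderOf_eq_one]⟩ 1
  simp only [Int.cast_one] at h
  simp [cyclicAction, h]

/-- `G_φ = G ⋊_φ ℤ_m = ⟨G, t ∣ t g t⁻¹ = φ(g), t ^ m = 1⟩`, where `m` is the order of `φ`. -/
abbrev CyclicExtension {G : Type*} [Group G] (φ : MulAut G) : Type _ :=
  SemidirectProduct G (Multiplicative (ZMod (orderOf φ))) (cyclicAction φ)

/-! ### Length spaces and Gromov hyperbolicity -/

/-- A metric space is a length space if the distance between any two points is the infimum of the
lengths of the paths joining them. -/
def IsLengthSpace (X : Type*) [MetricSpace X] : Prop :=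
  ∀ x y : X, edist x y = ⨅ γ : Path x y, eVariationOn γ Set.univ

/-- The Gromov product `(x ∣ y)_w`. -/
noncomputable def gromovProduct {X : Type*} [MetricSpace X] (w x y : X) : ℝ :=
  (dist x w + dist y w - dist x y) / 2

/-- Gromov's four-point condition: `(x ∣ z)_w ≥ min ((x ∣ y)_w, (y ∣ z)_w) - δ` for some
constant `δ`. -/
class GromovHyperbolicSpace (X : Type*) [MetricSpace X] : Prop where
  exists_delta : ∃ δ : ℝ, ∀ w x y z : X,
    min (gromovProduct w x y) (gromovProduct w y z) - δ ≤ gromovProduct w x z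

theorem gromovProduct_comm {X : Type*} [MetricSpace X] (w x y : X) :
    gromovProduct w x y = gromovProduct w y x := by
  simp [gromovProduct, dist_comm x y, add_comm]

/-! ### The Gromov boundary -/

/-- `(u i ∣ v j)_w → ∞` as `i, j → ∞`, for every base point `w`. -/
def GromovAsymptotic {X : Type*} [MetricSpace X] (u v : ℕ → X) : Prop :=
  ∀ w : X, Tendsto (fun p : ℕ × ℕ => gromovProduct w (u p.1) (v p.2)) atTop atTop

/-- Sequences converging to infinity: `(u i ∣ u j)_w → ∞` as `i, j → ∞`. -/
def GromovSequence (X : Type*) [MetricSpace X] : Type _ :=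
  { u : ℕ → X // GromovAsymptotic u u }

theorem GromovAsymptotic.symm {X : Type*} [MetricSpace X] {u v : ℕ → X}
    (h : GromovAsymptotic u v) : GromovAsymptotic v u := by
  intro w
  rw [tendsto_atTop]
  intro C
  obtain ⟨a, ha⟩ := eventually_atTop.1 ((tendsto_atTop.1 (h w)) C)
  refine eventually_atTop.2 ⟨(a.2, a.1), fun p hp => ?_⟩
  rw [gromovProduct_comm]
  exact ha (p.2, p.1) ⟨hp.2, hp.1⟩

theorem GromovAsymptotic.trans {X : Type*} [MetricSpace X] [GromovHyperbolicSpace X]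
    {u v w : ℕ → X} (h : GromovAsymptotic u v) (h' : GromovAsymptotic v w) :
    GromovAsymptotic u w := by
  obtain ⟨δ, hδ⟩ := GromovHyperbolicSpace.exists_delta (X := X)
  intro o
  rw [tendsto_atTop]
  intro C
  obtain ⟨a, ha⟩ := eventually_atTop.1 ((tendsto_atTop.1 (h o)) (C + δ))
  obtain ⟨b, hb⟩ := eventually_atTop.1 ((tendsto_atTop.1 (h' o)) (C + δ))
  refine eventually_atTop.2 ⟨(a.1, b.2), fun p hp => ?_⟩
  have h1 := ha (p.1, max a.2 b.1) ⟨hp.1, le_max_left _ _⟩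
  have h2 := hb (max a.2 b.1, p.2) ⟨le_max_right _ _, hp.2⟩
  have h3 := hδ o (u p.1) (v (max a.2 b.1)) (w p.2)
  have h4 := le_min h1 h2
  linarith

/-- Two sequences converging to infinity are equivalent if `(u i ∣ v j)_w → ∞`. -/
def gromovSetoid (X : Type*) [MetricSpace X] [GromovHyperbolicSpace X] :
    Setoid (GromovSequence X) where
  r u v := GromovAsymptotic u.1 v.1
  iseqv := ⟨fun u => u.2, fun h => h.symm, fun h h' => h.trans h'⟩

/-- The Gromov boundary `∂X`. -/
def GromovBoundary (X : Type*) [MetricSpace X] [GromovHyperbolicSpace X] : Type _ :=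
  Quotient (gromovSetoid X)

/-! ### Isometric actions -/

theorem GromovAsymptotic.smul {Γ X : Type*} [Group Γ] [MetricSpace X] [MulAction Γ X]
    [IsIsometricSMul Γ X] (g : Γ) {u v : ℕ → X} (h : GromovAsymptotic u v) :
    GromovAsymptotic (fun n => g • u n) (fun n => g • v n) := by
  intro w
  refine (h (g⁻¹ • w)).congr fun p => ?_
  have key : ∀ x : X, dist (g • x) w = dist x (g⁻¹ • w) := fun x => by
    rw [← dist_smul g x (g⁻¹ • w), smul_inv_smul]
  simp only [gromovProduct, key, dist_smul]

/-- The induced action of a group of isometries on the Gromov boundary: the class of `(u n)` is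
sent by `g` to the class of `(g • u n)`. -/
instance gromovBoundaryMulAction {Γ X : Type*} [Group Γ] [MetricSpace X]
    [GromovHyperbolicSpace X] [MulAction Γ X] [IsIsometricSMul Γ X] :
    MulAction Γ (GromovBoundary X) where
  smul g := Quotient.map (sa := gromovSetoid X) (sb := gromovSetoid X)
    (fun u => ⟨fun n => g • u.1 n, u.2.smul g⟩) (fun _ _ h => GromovAsymptotic.smul g h)
  one_smul := by
    intro ξ
    induction ξ using Quotient.inductionOn with
    | h u =>
      exact congrArg (Quotient.mk (gromovSetoid X)) (Subtype.ext (funext fun n => one_smul Γ _))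
  mul_smul := by
    intro g h ξ
    induction ξ using Quotient.inductionOn with
    | h u =>
      exact congrArg (Quotient.mk (gromovSetoid X))
        (Subtype.ext (funext fun n => mul_smul g h _))

/-- An element is elliptic if its orbits (under the cyclic group it generates) are bounded. -/
def IsEllipticElement {Γ : Type*} (X : Type*) [Group Γ] [MetricSpace X] [MulAction Γ X]
    (g : Γ) : Prop :=
  ∀ x : X, Bornology.IsBounded (Set.range fun n : ℤ => g ^ n • x)

/-- An isometric action on a Gromov-hyperbolic space is elementary if it consists of elliptic
elements, or has a global fixed point (in the space or in its boundary), or has a global fixed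
pair in the boundary, i.e. an invariant set of two boundary points. -/
def IsElementaryAction (Γ X : Type*) [Group Γ] [MetricSpace X] [GromovHyperbolicSpace X]
    [MulAction Γ X] [IsIsometricSMul Γ X] : Prop :=
  (∀ g : Γ, IsEllipticElement X g) ∨
  (∃ x : X, ∀ g : Γ, g • x = x) ∨
  (∃ ξ : GromovBoundary X, ∀ g : Γ, g • ξ = ξ) ∨
  (∃ ξ η : GromovBoundary X, ξ ≠ η ∧
    ∀ g : Γ, (g • ξ = ξ ∧ g • η = η) ∨ (g • ξ = η ∧ g • η = ξ))

/-! ### Gromov products and asymptotic sequences -/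

/-! In `G_φ` the relation `x ~ g x φ(g)⁻¹` becomes conjugation by `G` on the coset `Gt`, via `x ↦
xt`. With finitely many classes, every `s` in `Gt` is conjugate to one of finitely many elements, so
translation lengths on `Gt` are bounded. By hyperbolicity this bounds `d(x, s²x) - d(x, sx)`
uniformly (`exists_bound_of_finite_twistedConjClasses`).

If no element of `G_φ` is visibly loxodromic at `x`, the action is elementary
(`isElementaryAction_of_no_loxodromic`). Otherwise a power of a loxodromic element is a loxodromic
`g` in `G`. For `s` in `Gt`, all `s gⁿ` with `n ∈ ℤ` stay in `Gt`; the uniform bound then forces `s`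
to swap the two endpoints of `g` (`exists_swapped_pair`). As `Gt` generates `G_φ`, the pair of
endpoints is invariant and the action is again elementary. -/

/-- Gromov's four-point condition with constant `δ`. -/
def IsDeltaHyperbolic (X : Type*) [MetricSpace X] (δ : ℝ) : Prop :=
  ∀ w x y z : X, min (gromovProduct w x y) (gromovProduct w y z) - δ ≤ gromovProduct w x z

theorem exists_pos_delta (X : Type*) [MetricSpace X] [GromovHyperbolicSpace X] :
    ∃ δ : ℝ, 0 < δ ∧ IsDeltaHyperbolic X δ := by
  obtain ⟨δ, hδ⟩ := GromovHyperbolicSpace.exists_delta (X := X)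
  exact ⟨max δ 1, by positivity, fun w x y z => by
    linarith [hδ w x y z, le_max_left δ 1]⟩

theorem min_gromovProduct_chain {X : Type*} [MetricSpace X] {δ : ℝ} (hδ : IsDeltaHyperbolic X δ) (hδ0 : 0 < δ)
    {c : ℝ} (o x y z w : X) (hxy : c ≤ gromovProduct o x y) (hyz : c ≤ gromovProduct o y z)
    (hzw : c ≤ gromovProduct o z w) : c - 2 * δ ≤ gromovProduct o x w := by
  have h1 := hδ o x y z
  have h2 := hδ o x z w
  have h3 := le_min hxy hyz
  have h4 : c - δ ≤ min (gromovProduct o x z) (gromovProduct o z w) :=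
    le_min (by linarith) (by linarith)
  linarith

theorem gromovProduct_sub_dist_le {X : Type*} [MetricSpace X] (w w' x y : X) :
    gromovProduct w x y - dist w w' ≤ gromovProduct w' x y := by
  simp only [gromovProduct]
  have h1 := dist_triangle x w' w
  have h2 := dist_triangle y w' w
  rw [dist_comm w' w] at h1 h2
  linarith

theorem gromovProduct_sub_dist_right_le {X : Type*} [MetricSpace X] (w x y y' : X) :
    gromovProduct w x y - dist y y' ≤ gromovProduct w x y' := by
  simp only [gromovProduct]
  have h1 := dist_triangle y y' w
  have h2 := dist_triangle x y y'
  linarith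

theorem gromovAsymptotic_of_basepoint {X : Type*} [MetricSpace X] {u v : ℕ → X} (o : X)
    (h : ∀ C : ℝ, ∃ N : ℕ, ∀ i ≥ N, ∀ j ≥ N, C ≤ gromovProduct o (u i) (v j)) :
    GromovAsymptotic u v := by
  intro w
  rw [tendsto_atTop]
  intro C
  obtain ⟨N, hN⟩ := h (C + dist o w)
  refine eventually_atTop.2 ⟨(N, N), fun p hp => ?_⟩
  linarith [hN p.1 hp.1 p.2 hp.2, gromovProduct_sub_dist_le o w (u p.1) (v p.2)]

theorem GromovAsymptotic.exists_le {X : Type*} [MetricSpace X] {u v : ℕ → X}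
    (h : GromovAsymptotic u v) (o : X) (C : ℝ) :
    ∃ N : ℕ, ∀ i ≥ N, ∀ j ≥ N, C ≤ gromovProduct o (u i) (v j) := by
  obtain ⟨a, ha⟩ := eventually_atTop.1 ((tendsto_atTop.1 (h o)) C)
  exact ⟨max a.1 a.2, fun i hi j hj =>
    ha (i, j) ⟨(le_max_left _ _).trans hi, (le_max_right _ _).trans hj⟩⟩

/-- For one large `n`, chain `u i`, `u n`, `v n`, `v j`; this costs only `2δ`. -/
theorem gromovAsymptotic_of_diagonal {X : Type*} [MetricSpace X] [GromovHyperbolicSpace X]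
    {u v : ℕ → X} (hu : GromovAsymptotic u u) (hv : GromovAsymptotic v v) (o : X)
    (h : Tendsto (fun n => gromovProduct o (u n) (v n)) atTop atTop) :
    GromovAsymptotic u v := by
  obtain ⟨δ, hδ0, hδ⟩ := exists_pos_delta X
  refine gromovAsymptotic_of_basepoint o fun C => ?_
  obtain ⟨N₁, h₁⟩ := hu.exists_le o (C + 2 * δ)
  obtain ⟨N₂, h₂⟩ := hv.exists_le o (C + 2 * δ)
  obtain ⟨N₃, h₃⟩ := eventually_atTop.1 (tendsto_atTop.1 h (C + 2 * δ))
  have l₁ : N₁ ≤ max N₁ (max N₂ N₃) := le_max_left _ _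
  have l₂ : N₂ ≤ max N₁ (max N₂ N₃) := (le_max_left _ _).trans (le_max_right _ _)
  have l₃ : N₃ ≤ max N₁ (max N₂ N₃) := (le_max_right _ _).trans (le_max_right _ _)
  refine ⟨max N₁ (max N₂ N₃), fun i hi j hj => ?_⟩
  have := min_gromovProduct_chain hδ hδ0 o _ _ _ _ (h₁ i (l₁.trans hi) _ l₁) (h₃ _ l₃)
    (h₂ _ l₂ j (l₂.trans hj))
  linarith

/-- The boundary point defined by a sequence converging to infinity. -/
def GromovSequence.toBoundary {X : Type*} [MetricSpace X] [GromovHyperbolicSpace X]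
    (u : GromovSequence X) : GromovBoundary X :=
  Quotient.mk (gromovSetoid X) u

theorem GromovSequence.toBoundary_eq_iff {X : Type*} [MetricSpace X] [GromovHyperbolicSpace X]
    (u v : GromovSequence X) : u.toBoundary = v.toBoundary ↔ GromovAsymptotic u.1 v.1 :=
  Quotient.eq (r := gromovSetoid X)

theorem GromovSequence.smul_toBoundary_eq {Γ X : Type*} [Group Γ] [MetricSpace X]
    [GromovHyperbolicSpace X] [MulAction Γ X] [IsIsometricSMul Γ X] {s : Γ}
    (u v : GromovSequence X) (h : GromovAsymptotic (fun n => s • u.1 n) v.1) :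
    s • u.toBoundary = v.toBoundary :=
  (GromovSequence.toBoundary_eq_iff ⟨fun n => s • u.1 n, u.2.smul s⟩ v).2 h

/-! ### Displacements of powers of an isometry -/

section Displacement

variable {Γ X : Type*} [Group Γ] [MetricSpace X] [MulAction Γ X] [IsIsometricSMul Γ X]

theorem dist_smul_left_eq (g : Γ) (x y : X) : dist (g • x) y = dist x (g⁻¹ • y) := by
  rw [← dist_smul g x (g⁻¹ • y), smul_inv_smul]

theorem dist_inv_smul_self (g : Γ) (x : X) : dist x (g⁻¹ • x) = dist x (g • x) := by
  rw [← dist_smul_left_eq, dist_comm]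

/-- Expresses products of orbit points by displacements of `x` alone, so that later estimates are
linear in those. -/
theorem gromovProduct_smul_smul (x : X) (g h : Γ) :
    gromovProduct x (g • x) (h • x) =
      (dist x (g • x) + dist x (h • x) - dist x ((g⁻¹ * h) • x)) / 2 := by
  rw [gromovProduct, dist_comm _ x, dist_comm _ x, dist_smul_left_eq g x (h • x), mul_smul,
    dist_comm x (g • x)]

theorem dist_pow_smul_le (x : X) (g : Γ) (n : ℕ) :
    dist x (g ^ n • x) ≤ n * dist x (g • x) := by
  induction n with
  | zero => simp
  | succ n ih =>
    have h := dist_triangle x (g • x) (g ^ (n + 1) • x)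
    rw [pow_succ', mul_smul, dist_smul] at h
    rw [pow_succ', mul_smul]
    push_cast
    linarith

variable {δ : ℝ}

/-- A local-to-global principle: one gap between `g` and `g²`, beyond `2δ`, makes every further
power move `x` farther by the same excess. Such a `g` is loxodromic. -/
theorem dist_pow_succ_ge (hδ : IsDeltaHyperbolic X δ) {g : Γ} {x : X}
    (hg : dist x (g • x) + 2 * δ < dist x (g ^ 2 • x)) (hδ0 : 0 < δ) (n : ℕ) :
    dist x (g ^ n • x) + (dist x (g ^ 2 • x) - dist x (g • x) - 2 * δ) ≤
      dist x (g ^ (n + 1) • x) := by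
  induction n with
  | zero =>
    have h := dist_pow_smul_le x g 2
    push_cast at h
    simp only [pow_zero, one_smul, dist_self, zero_add, pow_one]
    linarith
  | succ n ih =>
    have h := hδ x (g • x) (g ^ 2 • x) (g ^ (n + 2) • x)
    have e₁ : dist (g • x) (g ^ 2 • x) = dist x (g • x) := by
      rw [pow_two, mul_smul, dist_smul]
    have e₂ : dist (g ^ 2 • x) (g ^ (n + 2) • x) = dist x (g ^ n • x) := by
      rw [add_comm n 2, pow_add, mul_smul, dist_smul]
    have e₃ : dist (g • x) (g ^ (n + 2) • x) = dist x (g ^ (n + 1) • x) := by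
      rw [pow_succ' g (n + 1), mul_smul, dist_smul]
    simp only [gromovProduct, dist_comm _ x, e₁, e₂, e₃] at h
    change _ ≤ dist x (g ^ (n + 2) • x)
    rcases le_total ((dist x (g • x) + dist x (g ^ 2 • x) - dist x (g • x)) / 2)
      ((dist x (g ^ 2 • x) + dist x (g ^ (n + 2) • x) - dist x (g ^ n • x)) / 2) with hm | hm
    · rw [min_eq_left hm] at h
      linarith
    -- Here displacement would drop from the `n`-th to the next power, against the induction
    -- hypothesis.
    · rw [min_eq_right hm] at h
      linarith

theorem dist_pow_add_ge (hδ : IsDeltaHyperbolic X δ) {g : Γ} {x : X}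
    (hg : dist x (g • x) + 2 * δ < dist x (g ^ 2 • x)) (hδ0 : 0 < δ) (n k : ℕ) :
    dist x (g ^ n • x) + k * (dist x (g ^ 2 • x) - dist x (g • x) - 2 * δ) ≤
      dist x (g ^ (n + k) • x) := by
  induction k with
  | zero => simp
  | succ k ih =>
    have h := dist_pow_succ_ge hδ hg hδ0 (n + k)
    rw [← add_assoc]
    push_cast
    linarith

theorem dist_sq_smul_le_of_linear_growth (hδ : IsDeltaHyperbolic X δ) (hδ0 : 0 < δ) {g : Γ}
    {x : X} {C M : ℝ} (hM : 0 ≤ M) (h : ∀ n : ℕ, dist x (g ^ n • x) ≤ C + n * M) :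
    dist x (g ^ 2 • x) ≤ dist x (g • x) + 2 * δ + M := by
  by_contra! hc
  obtain ⟨n, hn⟩ := exists_nat_gt
    (C / (dist x (g ^ 2 • x) - dist x (g • x) - 2 * δ - M))
  rw [div_lt_iff₀ (by linarith)] at hn
  have h₁ := dist_pow_add_ge hδ (g := g) (x := x) (by linarith) hδ0 0 n
  rw [zero_add, pow_zero, one_smul, dist_self] at h₁
  linarith [h n]

/-- Conjugating by `γ` changes the displacement of `rⁿ` by at most `2 d(x, γx)`, independently of
`n`, so the growth rate is still at most `d(x, rx)`. The resulting bound does not involve `γ`. -/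
theorem dist_sq_smul_le_of_conj (hδ : IsDeltaHyperbolic X δ) (hδ0 : 0 < δ) (γ r : Γ) (x : X) :
    dist x ((γ * r * γ⁻¹) ^ 2 • x) ≤
      dist x ((γ * r * γ⁻¹) • x) + 2 * δ + dist x (r • x) := by
  refine dist_sq_smul_le_of_linear_growth hδ hδ0 (C := 2 * dist x (γ • x)) dist_nonneg
    fun n => ?_
  rw [conj_pow, mul_assoc, mul_smul, dist_comm, dist_smul_left_eq, dist_comm, mul_smul]
  have h₁ := dist_triangle (γ⁻¹ • x) x (r ^ n • γ⁻¹ • x)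
  have h₂ := dist_triangle x (r ^ n • x) (r ^ n • γ⁻¹ • x)
  rw [dist_smul, dist_inv_smul_self] at h₂
  rw [dist_comm _ x, dist_inv_smul_self] at h₁
  linarith [dist_pow_smul_le x r n]

/-! ### Groups without loxodromic elements -/

/-- By `H`, `kx` and `k⁻¹x` lie in nearly the same direction for every `k`. If `gx` and `hx`
diverged early, then `gh` would have large displacement, and the chain `gx`, `ghx`, `(gh)⁻¹x`,
`h⁻¹x` would put `gx` close in direction to `h⁻¹x`, hence to `hx`. -/
theorem min_dist_le_gromovProduct (hδ : IsDeltaHyperbolic X δ) (hδ0 : 0 < δ) {x : X}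
    (H : ∀ g : Γ, dist x (g ^ 2 • x) ≤ dist x (g • x) + 2 * δ) (g h : Γ) :
    min (dist x (g • x)) (dist x (h • x)) / 2 - 3 * δ ≤ gromovProduct x (g • x) (h • x) := by
  by_contra! hc
  have hA := min_le_left (dist x (g • x)) (dist x (h • x))
  have hB := min_le_right (dist x (g • x)) (dist x (h • x))
  set c := gromovProduct x (g • x) (h • x) with hcdef
  have self : ∀ k : Γ, dist x (k • x) / 2 - δ ≤ gromovProduct x (k • x) (k⁻¹ • x) := by
    intro k
    have e := gromovProduct_smul_smul x k⁻¹ k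
    rw [inv_inv, dist_inv_smul_self, ← pow_two, gromovProduct_comm] at e
    linarith [H k]
  have h₁ : gromovProduct x (g⁻¹ • x) (h • x) ≤ c + δ := by
    by_contra! hh
    have h' := hδ x (g • x) (g⁻¹ • x) (h • x)
    have h'' : c + δ < min (gromovProduct x (g • x) (g⁻¹ • x))
      (gromovProduct x (g⁻¹ • x) (h • x)) := lt_min (by linarith [self g]) hh
    linarith
  have h₂ : gromovProduct x (g • x) (h⁻¹ • x) ≤ c + δ := by
    by_contra! hh
    have h' := hδ x (g • x) (h⁻¹ • x) (h • x)
    have h'' : c + δ < min (gromovProduct x (g • x) (h⁻¹ • x))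
      (gromovProduct x (h⁻¹ • x) (h • x)) :=
        lt_min hh (by rw [gromovProduct_comm]; linarith [self h])
    linarith
  have e := gromovProduct_smul_smul x g⁻¹ h
  rw [inv_inv, dist_inv_smul_self] at e
  have e₁ := gromovProduct_smul_smul x g (g * h)
  rw [inv_mul_cancel_left] at e₁
  have e₂ := gromovProduct_smul_smul x (g * h)⁻¹ h⁻¹
  rw [inv_inv, mul_inv_cancel_right, dist_inv_smul_self, dist_inv_smul_self] at e₂
  have key := min_gromovProduct_chain hδ hδ0 (c := c + 4 * δ) x (g • x) ((g * h) • x)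
    ((g * h)⁻¹ • x) (h⁻¹ • x) (by linarith) (by linarith [self (g * h)]) (by linarith)
  linarith

theorem isEllipticElement_of_dist_le {x : X} {C : ℝ} (H : ∀ g : Γ, dist x (g • x) ≤ C) (g : Γ) :
    IsEllipticElement X g := by
  intro y
  refine (Metric.isBounded_closedBall (x := y) (r := C + 2 * dist x y)).subset ?_
  rintro _ ⟨n, rfl⟩
  have h₁ := dist_triangle4 y x (g ^ n • x) (g ^ n • y)
  rw [dist_smul, dist_comm y x] at h₁
  rw [Metric.mem_closedBall, dist_comm]
  linarith [H (g ^ n)]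

/-- An unbounded orbit has a single limit point, because any two far orbit points have a large
Gromov product; that point is fixed by the group. -/
theorem isElementaryAction_of_no_loxodromic [GromovHyperbolicSpace X]
    (hδ : IsDeltaHyperbolic X δ) (hδ0 : 0 < δ) {x : X}
    (H : ∀ g : Γ, dist x (g ^ 2 • x) ≤ dist x (g • x) + 2 * δ) :
    IsElementaryAction Γ X := by
  by_cases hb : ∃ C : ℝ, ∀ g : Γ, dist x (g • x) ≤ C
  · obtain ⟨C, hC⟩ := hb
    exact Or.inl (isEllipticElement_of_dist_le hC)
  push Not at hb
  choose g hg using fun n : ℕ => hb n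
  have asymp : ∀ γ : Γ, GromovAsymptotic (fun n => γ • g n • x) (fun n => g n • x) := by
    intro γ
    refine gromovAsymptotic_of_basepoint x fun C => ?_
    obtain ⟨N, hN⟩ := exists_nat_ge (2 * (C + 3 * δ) + dist x (γ • x))
    have hγ := dist_nonneg (x := x) (y := γ • x)
    refine ⟨N, fun i hi j hj => ?_⟩
    have hi' : (N : ℝ) ≤ i := by exact_mod_cast hi
    have hj' : (N : ℝ) ≤ j := by exact_mod_cast hj
    have h := min_dist_le_gromovProduct hδ hδ0 H (γ * g i) (g j)
    have h₁ : dist x (g i • x) - dist x (γ • x) ≤ dist x ((γ * g i) • x) := by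
      have := dist_triangle (γ • x) x ((γ * g i) • x)
      rw [mul_smul, dist_smul, dist_comm (γ • x) x] at this
      rw [mul_smul]
      linarith
    have h₂ : 2 * (C + 3 * δ) ≤ min (dist x ((γ * g i) • x)) (dist x (g j • x)) :=
      le_min (by linarith [hg i]) (by linarith [hg j])
    rw [mul_smul] at h h₂
    linarith
  refine Or.inr (Or.inr (Or.inl ⟨GromovSequence.toBoundary ⟨fun n => g n • x, ?_⟩,
    fun γ => GromovSequence.smul_toBoundary_eq _ _ (asymp γ)⟩))
  simpa using asymp 1

/-! ### Fixed points of loxodromic elements -/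

/-- The exponent is a multiple of `m` so that the power can be taken inside `G`. -/
theorem exists_pow_large_gap (hδ : IsDeltaHyperbolic X δ) (hδ0 : 0 < δ) {g : Γ} {x : X}
    (hg : dist x (g • x) + 2 * δ < dist x (g ^ 2 • x)) {m : ℕ} (hm : 0 < m) (C : ℝ) :
    ∃ n : ℕ, dist x ((g ^ m) ^ n • x) + C < dist x (((g ^ m) ^ n) ^ 2 • x) := by
  obtain ⟨n, hn⟩ := exists_nat_gt (C / (dist x (g ^ 2 • x) - dist x (g • x) - 2 * δ))
  have hpos : 0 < dist x (g ^ 2 • x) - dist x (g • x) - 2 * δ := by linarith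
  rw [div_lt_iff₀ hpos] at hn
  have h := dist_pow_add_ge hδ hg hδ0 (m * n) (m * n)
  refine ⟨n, ?_⟩
  rw [← pow_mul, ← pow_mul, mul_two]
  have hmn : (n : ℝ) ≤ ((m * n : ℕ) : ℝ) := by exact_mod_cast Nat.le_mul_of_pos_left n hm
  have := mul_le_mul_of_nonneg_right hmn hpos.le
  linarith

theorem gromovProduct_pow_ge (hδ : IsDeltaHyperbolic X δ) (hδ0 : 0 < δ) {g : Γ} {x : X}
    (hg : dist x (g • x) + 2 * δ < dist x (g ^ 2 • x)) {n i j : ℕ} (hi : n ≤ i) (hj : n ≤ j) :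
    n * (dist x (g ^ 2 • x) - dist x (g • x) - 2 * δ) / 2 ≤
      gromovProduct x (g ^ i • x) (g ^ j • x) := by
  wlog hij : i ≤ j generalizing i j
  · rw [gromovProduct_comm]
    exact this hj hi (le_of_not_ge hij)
  obtain ⟨k, rfl⟩ := Nat.exists_eq_add_of_le hij
  have hpos : 0 < dist x (g ^ 2 • x) - dist x (g • x) - 2 * δ := by linarith
  have hin : (n : ℝ) ≤ i := by exact_mod_cast hi
  have h := dist_pow_add_ge hδ hg hδ0 k i
  have h₁ := mul_le_mul_of_nonneg_right hin hpos.le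
  rw [gromovProduct_smul_smul, pow_add g i k, inv_mul_cancel_left, ← pow_add, add_comm i k]
  linarith [dist_nonneg (x := x) (y := g ^ i • x)]

theorem gromovAsymptotic_pow_self (hδ : IsDeltaHyperbolic X δ) (hδ0 : 0 < δ) {g : Γ} {x : X}
    (hg : dist x (g • x) + 2 * δ < dist x (g ^ 2 • x)) :
    GromovAsymptotic (fun n : ℕ => g ^ n • x) (fun n : ℕ => g ^ n • x) := by
  refine gromovAsymptotic_of_basepoint x fun C => ?_
  have hpos : 0 < (dist x (g ^ 2 • x) - dist x (g • x) - 2 * δ) / 2 := by linarith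
  obtain ⟨N, hN⟩ := exists_nat_ge (C / ((dist x (g ^ 2 • x) - dist x (g • x) - 2 * δ) / 2))
  rw [div_le_iff₀ hpos] at hN
  refine ⟨N, fun i hi j hj => ?_⟩
  linarith [gromovProduct_pow_ge hδ hδ0 hg hi hj]

theorem dist_inv_gap {C : ℝ} {g : Γ} {x : X}
    (hg : dist x (g • x) + C < dist x (g ^ 2 • x)) :
    dist x (g⁻¹ • x) + C < dist x (g⁻¹ ^ 2 • x) := by
  rwa [inv_pow, dist_inv_smul_self, dist_inv_smul_self]

/-- If the two ends agreed, the chain `gx`, `g^(N+1)x`, `g^-(N+1)x`, `g⁻¹x` would make `(gx | g⁻¹x)`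
too large for the gap of `g`. -/
theorem not_gromovAsymptotic_pow_inv (hδ : IsDeltaHyperbolic X δ) (hδ0 : 0 < δ) {g : Γ} {x : X}
    (hg : dist x (g • x) + 4 * δ < dist x (g ^ 2 • x)) :
    ¬ GromovAsymptotic (fun n : ℕ => g ^ n • x) (fun n : ℕ => g⁻¹ ^ n • x) := by
  intro h
  have hg' := dist_inv_gap hg
  obtain ⟨N, hN⟩ := h.exists_le x
    ((dist x (g • x) + (dist x (g ^ 2 • x) - dist x (g • x) - 2 * δ)) / 2)
  have near : ∀ k : Γ, dist x (k • x) + 2 * δ < dist x (k ^ 2 • x) →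
      (dist x (k • x) + (dist x (k ^ 2 • x) - dist x (k • x) - 2 * δ)) / 2 ≤
        gromovProduct x (k • x) (k ^ (N + 1) • x) := by
    intro k hk
    have h₁ := dist_pow_succ_ge hδ hk hδ0 N
    rw [gromovProduct_smul_smul, pow_succ' k N, inv_mul_cancel_left, ← pow_succ']
    linarith
  have n₁ := near g (by linarith)
  have n₂ := near g⁻¹ (by linarith)
  rw [gromovProduct_comm, inv_pow g 2, dist_inv_smul_self, dist_inv_smul_self] at n₂
  have key := min_gromovProduct_chain hδ hδ0 x _ _ _ _ n₁
    (hN (N + 1) (Nat.le_succ N) (N + 1) (Nat.le_succ N)) n₂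
  have e := gromovProduct_smul_smul x g⁻¹ g
  rw [inv_inv, dist_inv_smul_self, ← pow_two, gromovProduct_comm] at e
  linarith

/-- If the elements `s * g ^ n` have bounded translation length, then `s` sends the attracting
fixed point of `g` to the repelling one. -/
theorem gromovAsymptotic_smul_pow_inv [GromovHyperbolicSpace X] (hδ : IsDeltaHyperbolic X δ)
    (hδ0 : 0 < δ) {g s : Γ} {x : X} {C : ℝ}
    (hg : dist x (g • x) + 2 * δ < dist x (g ^ 2 • x))
    (hs : ∀ n : ℕ, dist x ((s * g ^ n) ^ 2 • x) ≤ dist x ((s * g ^ n) • x) + C) :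
    GromovAsymptotic (fun n : ℕ => s • g ^ n • x) (fun n : ℕ => g⁻¹ ^ n • x) := by
  refine gromovAsymptotic_of_diagonal ((gromovAsymptotic_pow_self hδ hδ0 hg).smul s)
    (gromovAsymptotic_pow_self hδ hδ0 (dist_inv_gap hg)) x ?_
  rw [tendsto_atTop]
  intro K
  have hpos : 0 < dist x (g ^ 2 • x) - dist x (g • x) - 2 * δ := by linarith
  -- After doubling, one `d(x, sx)` pays for comparing `s gⁿ` with `gⁿ`, and two for replacing `(s
  -- gⁿ)⁻¹x` by `g⁻ⁿx`.
  obtain ⟨N, hN⟩ := exists_nat_ge ((2 * K + C + 3 * dist x (s • x)) /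
    (dist x (g ^ 2 • x) - dist x (g • x) - 2 * δ))
  rw [div_le_iff₀ hpos] at hN
  refine eventually_atTop.2 ⟨N, fun n hn => ?_⟩
  have hn' := mul_le_mul_of_nonneg_right (Nat.cast_le (α := ℝ).2 hn) hpos.le
  have h₁ := dist_pow_add_ge hδ hg hδ0 0 n
  rw [zero_add, pow_zero, one_smul, dist_self] at h₁
  have h₂ : dist x (g ^ n • x) - dist x (s • x) ≤ dist x ((s * g ^ n) • x) := by
    have := dist_triangle (s • x) x ((s * g ^ n) • x)
    rw [mul_smul, dist_smul, dist_comm (s • x) x] at this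
    rw [mul_smul]
    linarith
  -- With `a = s gⁿ`, `(ax | a⁻¹x)` equals `d(x, ax) - d(x, a²x)/2`, which is at least `(d(x, ax) -
  -- C)/2`.
  have e := gromovProduct_smul_smul x (s * g ^ n)⁻¹ (s * g ^ n)
  rw [inv_inv, dist_inv_smul_self, ← pow_two, gromovProduct_comm] at e
  have h₃ := gromovProduct_sub_dist_right_le x ((s * g ^ n) • x) ((s * g ^ n)⁻¹ • x)
    (g⁻¹ ^ n • x)
  have h₄ : dist ((s * g ^ n)⁻¹ • x) (g⁻¹ ^ n • x) = dist x (s • x) := by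
    rw [mul_inv_rev, mul_smul, ← inv_pow, dist_smul, dist_comm, dist_inv_smul_self]
  rw [h₄] at h₃
  rw [← mul_smul]
  linarith [hs n]

/-- A set of elements `s` such that all `s * g ^ n`, `n ∈ ℤ`, have bounded translation length
swaps the two fixed points of the loxodromic element `g`. -/
theorem exists_swapped_pair [GromovHyperbolicSpace X] (hδ : IsDeltaHyperbolic X δ)
    (hδ0 : 0 < δ) {g : Γ} {x : X} (hg : dist x (g • x) + 4 * δ < dist x (g ^ 2 • x))
    {S : Set Γ} {C : ℝ}
    (hS : ∀ s ∈ S, dist x (s ^ 2 • x) ≤ dist x (s • x) + C)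
    (hSg : ∀ s ∈ S, ∀ n : ℕ, s * g ^ n ∈ S ∧ s * g⁻¹ ^ n ∈ S) :
    ∃ ξ η : GromovBoundary X, ξ ≠ η ∧ ∀ s ∈ S, s • ξ = η ∧ s • η = ξ := by
  have h₁ : dist x (g • x) + 2 * δ < dist x (g ^ 2 • x) := by linarith
  have h₂ := dist_inv_gap h₁
  let u : GromovSequence X := ⟨fun n => g ^ n • x, gromovAsymptotic_pow_self hδ hδ0 h₁⟩
  let v : GromovSequence X := ⟨fun n => g⁻¹ ^ n • x, gromovAsymptotic_pow_self hδ hδ0 h₂⟩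
  refine ⟨u.toBoundary, v.toBoundary, fun h => ?_,
    fun s hs => ⟨u.smul_toBoundary_eq v ?_, v.smul_toBoundary_eq u ?_⟩⟩
  · exact not_gromovAsymptotic_pow_inv hδ hδ0 hg ((u.toBoundary_eq_iff v).1 h)
  · exact gromovAsymptotic_smul_pow_inv hδ hδ0 h₁ fun n => hS _ (hSg s hs n).1
  · have h := gromovAsymptotic_smul_pow_inv hδ hδ0 h₂ fun n => hS _ (hSg s hs n).2
    rwa [inv_inv] at h

end Displacement

/-! ### Invariant pairs -/

/-- The subgroup of elements preserving the pair `{ξ, η}`. -/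
def pairStabilizer (Γ : Type*) {A : Type*} [Group Γ] [MulAction Γ A] (ξ η : A) : Subgroup Γ where
  carrier := {g | (g • ξ = ξ ∧ g • η = η) ∨ (g • ξ = η ∧ g • η = ξ)}
  one_mem' := by simp
  mul_mem' := by
    rintro a b (⟨h₁, h₂⟩ | ⟨h₁, h₂⟩) (⟨h₃, h₄⟩ | ⟨h₃, h₄⟩) <;>
      simp [mul_smul, h₁, h₂, h₃, h₄]
  inv_mem' := by
    rintro a (⟨h₁, h₂⟩ | ⟨h₁, h₂⟩)
    · exact Or.inl ⟨by rw [inv_smul_eq_iff, h₁], by rw [inv_smul_eq_iff, h₂]⟩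
    · exact Or.inr ⟨by rw [inv_smul_eq_iff, h₂], by rw [inv_smul_eq_iff, h₁]⟩

/-! ### The coset of the generator in the cyclic extension -/

section CyclicExtension

variable {G : Type*} [Group G] (φ : MulAut G)

/-- The generator `t` of the cyclic factor of `CyclicExtension φ`. -/
noncomputable def cyclicExtensionGen : CyclicExtension φ :=
  SemidirectProduct.inr (Multiplicative.ofAdd 1)

theorem cyclicExtensionGen_mul_inl (g : G) :
    cyclicExtensionGen φ * SemidirectProduct.inl g =
      SemidirectProduct.inl (φ g) * cyclicExtensionGen φ := by
  have h := SemidirectProduct.inl_aut (φ := cyclicAction φ) (Multiplicative.ofAdd 1) g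
  rw [cyclicAction_one] at h
  simp [h, cyclicExtensionGen]

/-- The bridge from twisted to ordinary conjugacy: `φ(g⁻¹) t = t g⁻¹`. -/
theorem inl_twistedConj_mul_gen (g x : G) :
    (SemidirectProduct.inl (g * x * φ g⁻¹) * cyclicExtensionGen φ : CyclicExtension φ) =
      SemidirectProduct.inl g * (SemidirectProduct.inl x * cyclicExtensionGen φ) *
        (SemidirectProduct.inl g)⁻¹ := by
  rw [map_mul, map_mul, mul_assoc _ (SemidirectProduct.inl (φ g⁻¹)),
    ← cyclicExtensionGen_mul_inl, map_inv]
  simp only [mul_assoc]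

theorem subgroup_eq_top_of_coset {P : Subgroup (CyclicExtension φ)}
    (hP : ∀ k : G, SemidirectProduct.inl k * cyclicExtensionGen φ ∈ P) : P = ⊤ := by
  have ht : cyclicExtensionGen φ ∈ P := by simpa using hP 1
  refine (Subgroup.eq_top_iff' P).2 fun γ => ?_
  rw [← SemidirectProduct.inl_left_mul_inr_right γ]
  refine P.mul_mem ?_ ?_
  · simpa using P.mul_mem (hP γ.left) (P.inv_mem ht)
  · obtain ⟨j, hj⟩ := ZMod.intCast_surjective (Multiplicative.toAdd γ.right)
    have : (SemidirectProduct.inr γ.right : CyclicExtension φ) = cyclicExtensionGen φ ^ j := by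
      rw [cyclicExtensionGen, ← map_zpow, ← ofAdd_zsmul]
      simp [hj]
    rw [this]
    exact P.zpow_mem ht j

theorem exists_inl_eq_pow (γ : CyclicExtension φ) :
    ∃ k : G, γ ^ orderOf φ = SemidirectProduct.inl k := by
  have h : γ ^ orderOf φ ∈ (SemidirectProduct.rightHom :
      CyclicExtension φ →* Multiplicative (ZMod (orderOf φ))).ker := by
    rw [MonoidHom.mem_ker, map_pow]
    apply Multiplicative.toAdd.injective
    simp
  rw [← SemidirectProduct.range_inl_eq_ker_rightHom] at h
  obtain ⟨k, hk⟩ := h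
  exact ⟨k, hk.symm⟩

theorem exists_bound_of_finite_twistedConjClasses [Finite (TwistedConjClasses φ)]
    {X : Type*} [MetricSpace X] [MulAction (CyclicExtension φ) X]
    [IsIsometricSMul (CyclicExtension φ) X] {δ : ℝ} (hδ : IsDeltaHyperbolic X δ) (hδ0 : 0 < δ)
    (x : X) : ∃ C : ℝ, ∀ k : G,
      dist x ((SemidirectProduct.inl k * cyclicExtensionGen φ : CyclicExtension φ) ^ 2 • x) ≤
        dist x ((SemidirectProduct.inl k * cyclicExtensionGen φ : CyclicExtension φ) • x) + C := by
  obtain ⟨M, hM⟩ := (Set.finite_range fun c : TwistedConjClasses φ =>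
    dist x ((SemidirectProduct.inl (Quotient.out (s := twistedConjSetoid φ) c) *
      cyclicExtensionGen φ : CyclicExtension φ) • x)).bddAbove
  refine ⟨2 * δ + M, fun k => ?_⟩
  obtain ⟨g, hg⟩ := Quotient.mk_out (s := twistedConjSetoid φ) k
  have h₁ := hM ⟨Quotient.mk (twistedConjSetoid φ) k, rfl⟩
  have h₂ := dist_sq_smul_le_of_conj hδ hδ0 (SemidirectProduct.inl g)
    (SemidirectProduct.inl (Quotient.out (Quotient.mk (twistedConjSetoid φ) k)) *
      cyclicExtensionGen φ : CyclicExtension φ) x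
  rw [← inl_twistedConj_mul_gen, ← hg] at h₂
  linarith

end CyclicExtension

theorem theorem6p4 {G : Type*} [Group G] (φ : MulAut G) (hφ : IsOfFinOrder φ)
    {X : Type*} [MetricSpace X] [GromovHyperbolicSpace X] (hX : IsLengthSpace X)
    [MulAction (CyclicExtension φ) X] [IsIsometricSMul (CyclicExtension φ) X]
    (hne : ¬ IsElementaryAction (CyclicExtension φ) X) :
    Infinite (TwistedConjClasses φ) := by
  by_contra hfin
  rw [not_infinite_iff_finite] at hfin
  apply hne
  rcases isEmpty_or_nonempty X with hemp | ⟨⟨x⟩⟩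
  · exact Or.inl fun g y => hemp.elim y
  obtain ⟨δ, hδ0, hδ⟩ := exists_pos_delta X
  obtain ⟨C, hC⟩ := exists_bound_of_finite_twistedConjClasses φ hδ hδ0 x
  by_cases hlox : ∀ g : CyclicExtension φ, dist x (g ^ 2 • x) ≤ dist x (g • x) + 2 * δ
  · exact isElementaryAction_of_no_loxodromic hδ hδ0 hlox
  push Not at hlox
  obtain ⟨γ, hγ⟩ := hlox
  -- Finite order of `φ` makes the exponent positive; the gap `4δ` is what separates the two
  -- endpoints.
  obtain ⟨n, hn⟩ := exists_pow_large_gap hδ hδ0 hγ hφ.orderOf_pos (4 * δ)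
  obtain ⟨a, ha⟩ := exists_inl_eq_pow φ γ
  rw [ha, ← map_pow] at hn
  generalize a ^ n = b at hn
  have coset : ∀ (k c : G) (n : ℕ),
      (SemidirectProduct.inl k * cyclicExtensionGen φ * SemidirectProduct.inl c ^ n :
        CyclicExtension φ) = SemidirectProduct.inl (k * φ (c ^ n)) * cyclicExtensionGen φ := by
    intro k c n
    rw [← map_pow, mul_assoc, cyclicExtensionGen_mul_inl, map_mul, mul_assoc]
  obtain ⟨ξ, η, hne, hswap⟩ := exists_swapped_pair hδ hδ0 hn
    (S := Set.range fun k : G => SemidirectProduct.inl k * cyclicExtensionGen φ) (C := C)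
    (by rintro _ ⟨k, rfl⟩; exact hC k)
    (by
      rintro _ ⟨k, rfl⟩ n
      rw [← map_inv]
      exact ⟨⟨_, (coset k b n).symm⟩, ⟨_, (coset k b⁻¹ n).symm⟩⟩)
  have hP : pairStabilizer (CyclicExtension φ) ξ η = ⊤ :=
    subgroup_eq_top_of_coset φ fun k => Or.inr (hswap _ ⟨k, rfl⟩)
  exact Or.inr (Or.inr (Or.inr ⟨ξ, η, hne, fun g =>
    (hP ▸ Subgroup.mem_top g : g ∈ pairStabilizer (CyclicExtension φ) ξ η)⟩))
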